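/- **Tensors and traces.** Let $k\ge 2$, $n\ge 0$ and $d\ge 1$ be integers and $[n]=\{1,\dots,n\}$. For a $k$-order $n$-dimensional complex tensor $\mathcal A=(a_{i_1\cdots i_k})$, the $d$-th order trace is $$\mathrm{Tr}_d(\mathcal A)=(k-1)^{n-1}\sum_{m_1+\cdots+m_n=d}\ \prod_{i=1}^{n}\frac{1}{(m_i(k-1))!}\Bigl(\sum_{\beta\in[n]^{k-1}}\mathcal A_{i\beta}\,\frac{\partial}{\partial x_{i\beta}}\Bigr)^{m_i}\mathrm{tr}\bigl(X^{d(k-1)}\bigr),$$ where the $m_i$ are nonnegative integers, $X=(x_{ij})$ is an $n\times n$ matrix of indeterminates, and $\frac{\partial}{\partial x_{i\beta}}=\frac{\partial}{\partial x_{ii_2}}\cdots\frac{\partial}{\partial x_{ii_k}}$ for $\beta=i_2\cdots i_k$. **Hypergraphs.** Let $\mathcal H$ be a $k$-uniform hypergraph (without repeated hyperedges) with vertex set $[n]$ and vertex degrees $d_1,\dots,d_n$. Its adjacency tensor $\mathcal A(\mathcal H)$ has the entry $\frac1{(k-1)!}$ at $i_1\cdots i_k$ if $\{i_1,\dots,i_k\}\in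 E(\mathcal H)$, and $0$ otherwise; $\mathcal D(\mathcal H)$ is the diagonal tensor of vertex degrees. For real $\alpha$ with $0\le\alpha\le1$ put $\mathcal A_\alpha(\mathcal H)=\alpha\mathcal D(\mathcal H)+(1-\alpha)\mathcal A(\mathcal H)$ and $\phi(d)=(k-1)^{n-1}\alpha^d\sum_{i=1}^n d_i^d$. **Sequences of indices.** Let $\mathcal F_d$ be the set of all $f=(i_1\beta_1,\dots,i_d\beta_d)$ with $1\le i_1\le\cdots\le i_d\le n$ and $\beta_j\in[n]^{k-1}$. For $f\in\mathcal F_d$ with $\beta_j=i_{j2}\cdots i_{jk}$: * $\pi_f(\mathcal A)=\prod_{j=1}^d\mathcal A_{i_j\beta_j}$. * $D(f)$ is the multi-digraph with the $d(k-1)$ arcs $(i_j,i_{j2}),\dots,(i_j,i_{jk})$, $j=1,\dots,d$. Parallel arcs are distinguished. $V(f)$ is its vertex set (all endpoints of arcs), and $d^+(v)$ is the outdegree of $v$. * $\mathcal H_f$ is the multi-hypergraph with vertex set $V(f)$ whose hyperedges are the sets $\{i_j,i_{j2},\dots,i_{jk}\}$ having $k$ distinct elements, each with multiplicity the number of indices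 $j$ that give this set. **Veblen infragraphs.** A Veblen hypergraph is a $k$-uniform multi-hypergraph in which every vertex degree (counted with multiplicity) is a multiple of $k$. An infragraph of $\mathcal H$ is a multi-hypergraph that becomes a subhypergraph of $\mathcal H$ when duplicate hyperedges are removed. Let $\mathcal V_{d-1}(\mathcal H)$ be the set of all connected Veblen infragraphs of $\mathcal H$ with at least one and at most $d-1$ hyperedges, counted with multiplicity. These are labelled objects on subsets of $[n]$, not isomorphism classes. For $H'\in\mathcal V_{d-1}(\mathcal H)$ let $\mathcal F_d(H')$ be the set of all $f\in\mathcal F_d$ such that $\mathcal H_f=H'$ and $D(f)$ has an Euler tour (a closed walk using every arc exactly once). **Theorem.** For every $k$-uniform hypergraph $\mathcal H$ on $[n]$, every $d\ge1$ and every $\alpha\in[0,1]$, $$\mathrm{Tr}_d(\mathcal A_\alpha(\mathcal H))=\phi(d)+(1-\alpha)^d\,\mathrm{Tr}_d(\mathcal A(\mathcal H))+d(k-1)^n\sum_{H'\in\mathcal V_{d-1}(\mathcal H)}\ \sum_{f\in\mathcal F_d(H')}\frac{\tau(f)\,\pi_f(\mathcal A_\alpha(\mathcal H))}{\prod_{v\in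 V(f)}d^+(v)},$$ where $\tau(f)$ is the number of spanning trees of $D(f)$ rooted at, and with all arcs oriented towards, a specified vertex of $V(f)$. The formula holds for every choice of these roots, which may depend on $f$. -/

import Mathlib

open Finset
open scoped Classical

/-- A `k`-order `n`-dimensional complex tensor.  The multi-index `i₁ i₂ ⋯ i_k` is written as the
pair of its first index `i₁ : Fin n` and the word `i₂ ⋯ i_k : Fin (k - 1) → Fin n`. -/
abbrev Tensor (k n : ℕ) : Type := Fin n → (Fin (k - 1) → Fin n) → ℂ

/-! ### The trace of a tensor -/

/-- The operator `∑_α a_{iα} ∂/∂a_{iα}`, where `α = i₂ ⋯ i_k` and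
`∂/∂a_{iα} = ∂/∂a_{i i₂} ⋯ ∂/∂a_{i i_k}`, acting on polynomials in the entries of an auxiliary
`n × n` matrix. -/
noncomputable def Tensor.diffOp {k n : ℕ} (A : Tensor k n) (i : Fin n) :
    Module.End ℂ (MvPolynomial (Fin n × Fin n) ℂ) :=
  ∑ α : Fin (k - 1) → Fin n,
    A i α • (List.ofFn fun l : Fin (k - 1) =>
      ((MvPolynomial.pderiv (i, α l) :
        Derivation ℂ (MvPolynomial (Fin n × Fin n) ℂ) (MvPolynomial (Fin n × Fin n) ℂ)) :
          Module.End ℂ (MvPolynomial (Fin n × Fin n) ℂ))).prod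

/-- The `d`-th order trace
`Tr_d(A) = (k-1)^(n-1) ∑_{d₁+⋯+d_n=d} ∏_i 1/(d_i(k-1))! (∑_α a_{iα} ∂/∂a_{iα})^{d_i} tr(X^{d(k-1)})`,
where `X` is the generic `n × n` matrix.  The polynomial `tr(X^{d(k-1)})` is homogeneous of degree
`d(k-1)`, and the differential operators have total order `d(k-1)`, so that the result of the
differentiation is a constant polynomial, of which `constantCoeff` reads off the value. -/
noncomputable def Tensor.trace {k n : ℕ} (d : ℕ) (A : Tensor k n) : ℂ :=
  ((k - 1 : ℕ) : ℂ) ^ (n - 1) *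
    ∑ m ∈ Finset.piAntidiag (Finset.univ : Finset (Fin n)) d,
      MvPolynomial.constantCoeff
        ((List.ofFn fun i : Fin n =>
            (((m i * (k - 1)).factorial : ℂ)⁻¹ • (A.diffOp i) ^ (m i))).prod
          (Matrix.trace ((Matrix.mvPolynomialX (Fin n) (Fin n) ℂ) ^ (d * (k - 1)))))

/-! ### Hypergraphs and their tensors -/

/-- Every hyperedge has exactly `k` vertices. -/
def Hypergraph.IsKUniform {V : Type*} (H : Hypergraph V) (k : ℕ) : Prop :=
  ∀ e ∈ H.edgeSet, e.ncard = k

/-- The number of hyperedges that contain `v`. -/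
noncomputable def Hypergraph.vertexDegree {V : Type*} (H : Hypergraph V) (v : V) : ℕ :=
  {e ∈ H.edgeSet | v ∈ e}.ncard

/-- A multi-index `i α = i i₂ ⋯ i_k`. -/
abbrev MultiIndex (k n : ℕ) : Type := Fin n × (Fin (k - 1) → Fin n)

/-- The set `{i, i₂, …, i_k}` of the entries of a multi-index. -/
def MultiIndex.support {k n : ℕ} (x : MultiIndex k n) : Finset (Fin n) :=
  insert x.1 (Finset.univ.image x.2)

/-- The adjacency tensor: `1/(k-1)!` at `i₁ ⋯ i_k` if `{i₁, …, i_k}` is a hyperedge, and `0`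
otherwise. -/
noncomputable def Hypergraph.adjTensor (k : ℕ) {n : ℕ} (H : Hypergraph (Fin n)) : Tensor k n :=
  fun i α =>
    if (MultiIndex.support (k := k) (i, α) : Set (Fin n)) ∈ H.edgeSet then
      (((k - 1).factorial : ℕ) : ℂ)⁻¹
    else 0

/-- The diagonal tensor of vertex degrees. -/
noncomputable def Hypergraph.degreeTensor (k : ℕ) {n : ℕ} (H : Hypergraph (Fin n)) :
    Tensor k n :=
  fun i α => if ∀ l, α l = i then (H.vertexDegree i : ℂ) else 0

/-- The tensor `A_α(H) = α D(H) + (1 - α) A(H)`. -/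
noncomputable def Hypergraph.alphaTensor (k : ℕ) {n : ℕ} (H : Hypergraph (Fin n)) (α : ℝ) :
    Tensor k n :=
  (α : ℂ) • H.degreeTensor k + (1 - (α : ℂ)) • H.adjTensor k

/-- `φ(s) = (k-1)^(n-1) α^s ∑_i d_i^s`. -/
noncomputable def Hypergraph.phi (k : ℕ) {n : ℕ} (H : Hypergraph (Fin n)) (α : ℝ) (s : ℕ) : ℂ :=
  ((k - 1 : ℕ) : ℂ) ^ (n - 1) * (α : ℂ) ^ s * ∑ i : Fin n, (H.vertexDegree i : ℂ) ^ s

/-! ### Sequences of multi-indices and their multi-digraphs -/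

/-- `d` multi-indices `(i₁α₁, …, i_dα_d)`. -/
abbrev IndexSeq (d k n : ℕ) : Type := Fin d → MultiIndex k n

namespace IndexSeq

variable {d k n : ℕ}

/-- The condition `i₁ ≤ ⋯ ≤ i_d`, which cuts out `F_d`. -/
def IsOrdered (f : IndexSeq d k n) : Prop :=
  Monotone fun j => (f j).1

/-- The product `∏_j A_{i_jα_j}`. -/
def tensorProd (f : IndexSeq d k n) (A : Tensor k n) : ℂ :=
  ∏ j, A (f j).1 (f j).2

/-- The arcs of the multi-digraph `D(f)` are the pairs `(j, l)`, so that parallel arcs are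
distinguished; the arc `(j, l)` goes from `i_j` to the `l`-th letter of `α_j`. -/
abbrev Arc (d k : ℕ) : Type := Fin d × Fin (k - 1)

/-- The tail of an arc of `D(f)`. -/
def src (f : IndexSeq d k n) (a : Arc d k) : Fin n := (f a.1).1

/-- The head of an arc of `D(f)`. -/
def tgt (f : IndexSeq d k n) (a : Arc d k) : Fin n := (f a.1).2 a.2

/-- The vertex set `V(f)` of `D(f)`: all letters that occur in `f`.  For `k ≥ 2` these are the
endpoints of the arcs. -/
def verts (f : IndexSeq d k n) : Finset (Fin n) :=
  Finset.univ.biUnion fun j => (f j).support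

/-- The outdegree `d⁺(v)` in `D(f)`. -/
def outDegree (f : IndexSeq d k n) (v : Fin n) : ℕ :=
  (Finset.univ.filter fun a : Arc d k => f.src a = v).card

/-- `D(f)` has an Euler tour: its arcs can be arranged cyclically, each of them once, such that
each arc ends where the next one starts. -/
def HasEulerTour (f : IndexSeq d k n) : Prop :=
  ∃ e : Fin (d * (k - 1)) ≃ Arc d k,
    ∀ m, f.tgt (e m) = f.src (e (finRotate (d * (k - 1)) m))

/-- The set `T` of arcs is a spanning tree of `D(f)` rooted at `r` and oriented towards `r`: no arc
of `T` leaves `r`, exactly one arc of `T` leaves each other vertex, and `r` can be reached from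
each vertex along arcs of `T`. -/
def IsRootedSpanningTree (f : IndexSeq d k n) (r : Fin n) (T : Finset (Arc d k)) : Prop :=
  (∀ a ∈ T, f.src a ≠ r) ∧
  (∀ v ∈ f.verts, v ≠ r → ∃! a, a ∈ T ∧ f.src a = v) ∧
  (∀ v ∈ f.verts, Relation.ReflTransGen (fun u w => ∃ a ∈ T, f.src a = u ∧ f.tgt a = w) v r)

/-- The number `τ(f)` of spanning trees of `D(f)` with root `r`. -/
noncomputable def tau (f : IndexSeq d k n) (r : Fin n) : ℕ :=
  (Finset.univ.filter fun T : Finset (Arc d k) => f.IsRootedSpanningTree r T).card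

end IndexSeq

/-! ### Multi-hypergraphs -/

/-- A multi-hypergraph with vertices among `1, …, n`. -/
@[ext]
structure MultiHypergraph (n : ℕ) where
  verts : Finset (Fin n)
  edges : Multiset (Finset (Fin n))
  edge_subset : ∀ e ∈ edges, e ⊆ verts

namespace MultiHypergraph

variable {n : ℕ}

/-- The number of hyperedges, with multiplicity, that contain `v`. -/
def degree (G : MultiHypergraph n) (v : Fin n) : ℕ :=
  G.edges.countP fun e => v ∈ e

/-- A Veblen hypergraph: `k`-uniform, with all degrees divisible by `k`. -/
def IsVeblen (k : ℕ) (G : MultiHypergraph n) : Prop :=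
  (∀ e ∈ G.edges, e.card = k) ∧ ∀ v ∈ G.verts, k ∣ G.degree v

/-- Any two vertices are joined by a walk along hyperedges. -/
def IsConnected (G : MultiHypergraph n) : Prop :=
  G.verts.Nonempty ∧ ∀ u ∈ G.verts, ∀ v ∈ G.verts,
    Relation.ReflTransGen (fun x y => ∃ e ∈ G.edges, x ∈ e ∧ y ∈ e) u v

/-- Removing duplicate hyperedges leaves a subhypergraph of `H`. -/
def IsInfragraph (G : MultiHypergraph n) (H : Hypergraph (Fin n)) : Prop :=
  (G.verts : Set (Fin n)) ⊆ H.vertexSet ∧ ∀ e ∈ G.edges, (e : Set (Fin n)) ∈ H.edgeSet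

/-- Only finitely many multi-hypergraphs have at most `h` hyperedges. -/
theorem finite_card_le (n h : ℕ) : {G : MultiHypergraph n | G.edges.card ≤ h}.Finite := by
  have hfin : ((Set.univ : Set (Finset (Fin n))) ×ˢ
      (Set.Icc 0 (h • (Finset.univ : Finset (Finset (Fin n))).val))).Finite :=
    Set.finite_univ.prod (Set.finite_Icc _ _)
  refine Set.Finite.of_finite_image (f := fun G => (G.verts, G.edges)) (hfin.subset ?_) ?_
  · rintro _ ⟨G, hG, rfl⟩
    refine ⟨Set.mem_univ _, Multiset.zero_le _, ?_⟩
    rw [Multiset.le_iff_count]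
    intro e
    rw [Multiset.count_nsmul, Multiset.count_eq_one_of_mem Finset.univ.nodup (by simp)]
    simpa using (Multiset.count_le_card e G.edges).trans hG
  · intro G _ G' _ hGG'
    simp only [Prod.mk.injEq] at hGG'
    exact MultiHypergraph.ext hGG'.1 hGG'.2

end MultiHypergraph

/-- The set of all connected Veblen infragraphs of `H` with at least one and at most `h`
hyperedges. -/
noncomputable def Hypergraph.veblenInfragraphs (k : ℕ) {n : ℕ} (H : Hypergraph (Fin n)) (h : ℕ) :
    Finset (MultiHypergraph n) :=
  (MultiHypergraph.finite_card_le n h).toFinset.filter fun G =>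
    G.IsInfragraph H ∧ G.IsVeblen k ∧ G.IsConnected ∧ G.edges ≠ 0

/-- The multi-hypergraph `H_f` on the vertex set `V(f)`: its hyperedges are the sets
`{i_j, i_{j2}, …, i_{jk}}` that consist of `k` distinct vertices, each one with the number of such
`j` as its multiplicity. -/
def IndexSeq.hypergraph {d k n : ℕ} (f : IndexSeq d k n) : MultiHypergraph n where
  verts := f.verts
  edges := (Finset.univ.filter fun j => (f j).support.card = k).val.map fun j => (f j).support
  edge_subset := by
    intro e he
    obtain ⟨j, -, rfl⟩ := Multiset.mem_map.1 he
    exact Finset.subset_biUnion_of_mem (fun j => (f j).support) (Finset.mem_univ j)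

/-- The set `F_d(G)` of all `f ∈ F_d` with `H_f = G` whose multi-digraph `D(f)` has an Euler
tour. -/
noncomputable def MultiHypergraph.indexSeqs (d k : ℕ) {n : ℕ} (G : MultiHypergraph n) :
    Finset (IndexSeq d k n) :=
  Finset.univ.filter fun f => f.IsOrdered ∧ f.hypergraph = G ∧ f.HasEulerTour

/-! ### Counting Euler trails -/

/-! Every product of row operators in the trace is a polynomial in the commuting `∂/∂x_{ij}`. Its
expansion has one monomial `∏ ∂/∂(arc)` for each `f ∈ F_d`, with coefficient `π_f / ∏ d⁺(v)!`.
Applied to `tr(X^N)`, `N = d(k-1)`, such a monomial gives the number of cyclic arrangements of the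
arcs of `D(f)`, with a marked start (`Tensor.trace_eq_sum_tours`). The BEST theorem evaluates this
number as `N τ(f) ∏ (d⁺(v)-1)!`, so that `f` has total weight `d(k-1)^n τ(f) π_f / ∏ d⁺(v)`
(`Tensor.trace_eq_sum_tau`).

For `A_α`, a nonzero `π_f` forces each term of `f` to be diagonal or a hyperedge. Split by the
number `c` of hyperedge terms. If `c = 0`, all arcs are loops, and an Euler tour puts them at a
single vertex; this gives `φ(d)`. If `c = d`, each factor is `1-α` times an adjacency entry; this
gives `(1-α)^d Tr_d(A)`. If `0 < c < d`, the tour makes `H_f` connected and its balance of in- and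
outdegrees makes `H_f` Veblen; grouping by `H_f` gives the last sum.

The BEST theorem rests on `ArcTrail.card_trails_eq`: deleting the first arc of a trail gives a
recursion for the number of trails, and the tree formula satisfies the same recursion. -/

namespace ArcTrail

variable {E V : Type*} (s t : E → V)

/-- The list of arcs (with tails `s` and heads `t`) is a walk from `v` to `r`. -/
def IsTrail : V → List E → V → Prop
  | v, [], r => v = r
  | v, a :: l, r => s a = v ∧ IsTrail (t a) l r

/-- The trails from `v` to `r` that use each arc of `S` exactly once, and no other arc. -/
noncomputable def trails (S : Finset E) (v r : V) : Finset (List E) :=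
  S.toList.permutations.toFinset.filter fun l => IsTrail s t v l r

/-- The number of elements of `S` in the fibre of `g` over `w`. -/
noncomputable def fiberCard (g : E → V) (S : Finset E) (w : V) : ℕ :=
  (S.filter fun a => g a = w).card

/-- The set `T` of arcs is a spanning tree of `S`, oriented towards its root `r`. -/
def IsTree (S : Finset E) (r : V) (T : Finset E) : Prop :=
  (∀ a ∈ T, s a ≠ r) ∧
  (∀ v, (∃ a ∈ S, s a = v) → v ≠ r → ∃! a, a ∈ T ∧ s a = v) ∧
  (∀ v, (∃ a ∈ S, s a = v) → Relation.ReflTransGen (fun u w => ∃ a ∈ T, s a = u ∧ t a = w) v r)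

/-- The spanning trees of `S` oriented towards `r`. -/
noncomputable def trees (S : Finset E) (r : V) : Finset (Finset E) :=
  S.powerset.filter fun T => IsTree s t S r T

variable {s t}

theorem mem_trails {S : Finset E} {v r : V} {l : List E} :
    l ∈ trails s t S v r ↔ (l.Nodup ∧ l.toFinset = S) ∧ IsTrail s t v l r := by
  simp only [trails, mem_filter, List.mem_toFinset, List.mem_permutations]
  refine and_congr_left fun _ => ⟨fun h => ⟨h.nodup_iff.2 S.nodup_toList, ?_⟩, ?_⟩
  · rw [List.toFinset_eq_of_perm _ _ h, Finset.toList_toFinset]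
  · rintro ⟨h, rfl⟩
    exact (List.toFinset_toList h).symm

theorem mem_trees {S : Finset E} {r : V} {T : Finset E} :
    T ∈ trees s t S r ↔ T ⊆ S ∧ IsTree s t S r T := by
  simp [trees]

theorem card_trails_empty (v r : V) :
    (trails s t ∅ v r).card = if v = r then 1 else 0 := by
  have : trails s t ∅ v r = if v = r then {[]} else ∅ := by
    ext l
    rw [mem_trails]
    constructor
    · rintro ⟨⟨-, h⟩, h'⟩
      rw [List.toFinset_eq_empty_iff] at h
      subst h
      simp [IsTrail] at h'
      simp [h']
    · intro h
      split_ifs at h with hv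
      · simp at h
        subst h
        simp [IsTrail, hv]
      · simp at h
  rw [this]
  split_ifs <;> simp

theorem card_trails {S : Finset E} (hS : S.Nonempty) (v r : V) :
    (trails s t S v r).card =
      ∑ b ∈ S.filter fun a => s a = v, (trails s t (S.erase b) (t b) r).card := by
  have : trails s t S v r = (S.filter fun a => s a = v).biUnion fun b =>
      (trails s t (S.erase b) (t b) r).image (List.cons b) := by
    ext l
    simp only [mem_biUnion, mem_image, mem_filter, mem_trails]
    constructor
    · rintro ⟨⟨h1, h2⟩, h3⟩
      cases l with
      | nil => simp at h2; exact absurd h2.symm hS.ne_empty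
      | cons b l =>
        simp only [List.nodup_cons] at h1
        refine ⟨b, ⟨by rw [← h2]; simp, h3.1⟩, l, ⟨⟨h1.2, ?_⟩, h3.2⟩, rfl⟩
        rw [← h2, List.toFinset_cons, erase_insert]
        simpa using h1.1
    · rintro ⟨b, ⟨hb, hb'⟩, l, ⟨⟨h1, h2⟩, h3⟩, rfl⟩
      refine ⟨⟨List.nodup_cons.2 ⟨fun h => ?_, h1⟩, ?_⟩, hb', h3⟩
      · rw [← List.mem_toFinset, h2] at h
        simp at h
      · rw [List.toFinset_cons, h2, insert_erase hb]
  rw [this, card_biUnion]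
  · exact sum_congr rfl fun b _ => card_image_of_injective _ List.cons_injective
  · intro b _ c _ hbc
    simp only [Function.onFun, disjoint_left, mem_image]
    rintro _ ⟨l, -, rfl⟩ ⟨l', -, h⟩
    exact hbc (List.cons.inj h).1.symm

theorem fiberCard_erase (g : E → V) {S : Finset E} {b : E} (hb : b ∈ S) (w : V) :
    fiberCard g S w = fiberCard g (S.erase b) w + if g b = w then 1 else 0 := by
  unfold fiberCard
  rw [filter_erase]
  split_ifs with h
  · rw [card_erase_add_one]
    simp [hb, h]
  · rw [erase_eq_of_notMem]
    · rfl
    · simp [h]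

theorem fiberCard_pos {g : E → V} {S : Finset E} {w : V} :
    0 < fiberCard g S w ↔ ∃ a ∈ S, g a = w := by
  simp [fiberCard, card_pos, Finset.Nonempty]

/-- Adding an arc from `r` to `v` to the arcs of `S` makes all indegrees equal to the outdegrees. -/
def Balanced (s t : E → V) (S : Finset E) (v r : V) : Prop :=
  ∀ w, (fiberCard s S w + if r = w then 1 else 0) = fiberCard t S w + if v = w then 1 else 0

theorem Balanced.erase {S : Finset E} {r : V} {b : E} (h : Balanced s t S (s b) r) (hb : b ∈ S) :
    Balanced s t (S.erase b) (t b) r := by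
  intro w
  have h1 := h w
  rw [fiberCard_erase s hb, fiberCard_erase t hb] at h1
  omega

/-- A tree has no arc out of its root, so such an arc can never be used. Deleting it affects at most
whether the root is still a tail, and the tree conditions are trivial there. -/
theorem mem_trees_erase_of_src_eq_root {S : Finset E} {b : E} {T : Finset E} :
    T ∈ trees s t (S.erase b) (s b) ↔ T ∈ trees s t S (s b) := by
  have key : ∀ v, v ≠ s b → ((∃ a ∈ S.erase b, s a = v) ↔ ∃ a ∈ S, s a = v) := by
    intro v hv
    constructor
    · rintro ⟨a, ha, h⟩
      exact ⟨a, mem_of_mem_erase ha, h⟩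
    · rintro ⟨a, ha, rfl⟩
      exact ⟨a, mem_erase.2 ⟨fun h => hv (by rw [h]), ha⟩, rfl⟩
  simp only [mem_trees, IsTree]
  constructor
  · rintro ⟨h0, h1, h2, h3⟩
    refine ⟨h0.trans (erase_subset _ _), h1, fun v hv hvr => h2 v ((key v hvr).2 hv) hvr, ?_⟩
    intro v hv
    by_cases hvr : v = s b
    · rw [hvr]
    · exact h3 v ((key v hvr).2 hv)
  · rintro ⟨h0, h1, h2, h3⟩
    refine ⟨fun a ha => mem_erase.2 ⟨?_, h0 ha⟩, h1,
      fun v hv hvr => h2 v ((key v hvr).1 hv) hvr, ?_⟩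
    · rintro rfl
      exact h1 _ ha rfl
    intro v hv
    by_cases hvr : v = s b
    · rw [hvr]
    · exact h3 v ((key v hvr).1 hv)

theorem mem_trees_erase_of_two_le {S : Finset E} {r : V} {b : E} (hb : b ∈ S)
    (h : 2 ≤ fiberCard s S (s b)) {T : Finset E} :
    T ∈ trees s t (S.erase b) r ↔ T ∈ trees s t S r ∧ b ∉ T := by
  have key : ∀ v, ((∃ a ∈ S.erase b, s a = v) ↔ ∃ a ∈ S, s a = v) := by
    intro v
    rw [← fiberCard_pos, ← fiberCard_pos, fiberCard_erase s hb v]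
    rw [fiberCard_erase s hb] at h
    split_ifs with hv
    · rw [if_pos rfl, hv] at h
      omega
    · rfl
  simp only [mem_trees, IsTree, key, subset_erase]
  tauto

/-- Double counting of pairs `(b, T)` with `b ∉ T`: a tree contains exactly one of the arcs out of
`v ≠ r`, hence avoids all the others. -/
theorem sum_card_trees_erase {S : Finset E} {v r : V} (hvr : v ≠ r) (h : 2 ≤ fiberCard s S v) :
    ∑ b ∈ S.filter fun a => s a = v, (trees s t (S.erase b) r).card =
      (fiberCard s S v - 1) * (trees s t S r).card := by
  have h1 : ∀ b ∈ S.filter fun a => s a = v, (trees s t (S.erase b) r).card =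
      ((trees s t S r).filter fun T => b ∉ T).card := by
    intro b hb
    rw [mem_filter] at hb
    obtain ⟨hb, rfl⟩ := hb
    congr 1
    ext T
    rw [mem_trees_erase_of_two_le hb h, mem_filter]
  rw [sum_congr rfl h1]
  have := Finset.sum_card_bipartiteAbove_eq_sum_card_bipartiteBelow
    (s := S.filter fun a => s a = v) (t := trees s t S r) (fun b T => b ∉ T)
  unfold bipartiteAbove bipartiteBelow at this
  rw [this, sum_congr rfl (g := fun _ => fiberCard s S v - 1), sum_const, smul_eq_mul, mul_comm]
  intro T hT
  obtain ⟨hTS, h1, h2, h3⟩ := mem_trees.1 hT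
  obtain ⟨a, ⟨haT, hav⟩, ha⟩ := h2 v (fiberCard_pos.1 (by omega)) hvr
  have : (S.filter fun a => s a = v).filter (fun b => b ∉ T) =
      (S.filter fun a => s a = v).erase a := by
    ext b
    simp only [mem_filter, mem_erase]
    constructor
    · rintro ⟨⟨hb, hb'⟩, hbT⟩
      exact ⟨fun h => hbT (h ▸ haT), hb, hb'⟩
    · rintro ⟨hba, hb, hb'⟩
      exact ⟨⟨hb, hb'⟩, fun h => hba (ha b ⟨h, hb'⟩)⟩
  rw [this, card_erase_of_mem (by simp [hTS haT, hav])]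
  rfl

theorem reflTransGen_mono_arcs {T T' : Finset E} (h : T ⊆ T') {v w : V}
    (hp : Relation.ReflTransGen (fun u w => ∃ a ∈ T, s a = u ∧ t a = w) v w) :
    Relation.ReflTransGen (fun u w => ∃ a ∈ T', s a = u ∧ t a = w) v w :=
  Relation.ReflTransGen.mono (fun _ _ ⟨a, ha, h'⟩ => ⟨a, h ha, h'⟩) _ _ hp

/-- No arc enters the tail of `b`, so a path that starts elsewhere never gets there and cannot use
`b`. -/
theorem reflTransGen_of_insert {T : Finset E} {b : E} (hT : ∀ a ∈ T, t a ≠ s b)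
    (hb : t b ≠ s b) {v w : V} (hv : v ≠ s b)
    (hp : Relation.ReflTransGen (fun u w => ∃ a ∈ insert b T, s a = u ∧ t a = w) v w) :
    Relation.ReflTransGen (fun u w => ∃ a ∈ T, s a = u ∧ t a = w) v w ∧ w ≠ s b := by
  induction hp with
  | refl => exact ⟨.refl, hv⟩
  | tail _ h ih =>
    obtain ⟨a, ha, rfl, rfl⟩ := h
    rcases mem_insert.1 ha with rfl | ha
    · exact absurd rfl ih.2
    · exact ⟨ih.1.tail ⟨a, ha, rfl, rfl⟩, hT a ha⟩

/-- Balance with outdegree one at the start of the trail forces indegree zero there. So `b` hangs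
off as a leaf arc: it lies in every tree, and no other vertex needs it to reach the root. -/
theorem card_trees_erase_leaf {S : Finset E} {r : V} {b : E} (hb : b ∈ S) (hbr : s b ≠ r)
    (hbal : Balanced s t S (s b) r) (h : fiberCard s S (s b) = 1) :
    (trees s t (S.erase b) r).card = (trees s t S r).card := by
  have hin : ∀ a ∈ S, t a ≠ s b := by
    intro a ha hab
    have h1 := hbal (s b)
    rw [h, if_neg hbr.symm, if_pos rfl] at h1
    have : 0 < fiberCard t S (s b) := fiberCard_pos.2 ⟨a, ha, hab⟩
    omega
  have huniq : ∀ a ∈ S, s a = s b → a = b := by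
    intro a ha hab
    unfold fiberCard at h
    obtain ⟨c, hc⟩ := card_eq_one.1 h
    have h1 : a ∈ S.filter fun a => s a = s b := by simp [ha, hab]
    have h2 : b ∈ S.filter fun a => s a = s b := by simp [hb]
    rw [hc, mem_singleton] at h1 h2
    rw [h1, h2]
  refine card_bij' (fun T _ => insert b T) (fun T _ => T.erase b) ?_ ?_ ?_ ?_
  · intro T hT
    obtain ⟨hTS, h1, h2, h3⟩ := mem_trees.1 hT
    have htb : Relation.ReflTransGen (fun u w => ∃ a ∈ T, s a = u ∧ t a = w) (t b) r := by
      by_cases hr : t b = r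
      · rw [hr]
      · refine h3 _ (fiberCard_pos.1 ?_)
        have := hbal.erase hb (t b)
        rw [if_neg (Ne.symm hr), if_pos rfl] at this
        omega
    refine mem_trees.2 ⟨insert_subset hb (hTS.trans (erase_subset _ _)), ?_, ?_, ?_⟩
    · intro a ha
      rcases mem_insert.1 ha with rfl | ha
      · exact hbr
      · exact h1 a ha
    · rintro v ⟨a, ha, rfl⟩ hvr
      by_cases hab : a = b
      · subst hab
        refine ⟨a, ⟨mem_insert_self _ _, rfl⟩, ?_⟩
        rintro c ⟨hc, hca⟩
        rcases mem_insert.1 hc with rfl | hc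
        · rfl
        · exact huniq c (mem_of_mem_erase (hTS hc)) hca
      · obtain ⟨c, ⟨hc, hca⟩, hc'⟩ := h2 (s a) ⟨a, mem_erase.2 ⟨hab, ha⟩, rfl⟩ hvr
        refine ⟨c, ⟨mem_insert_of_mem hc, hca⟩, ?_⟩
        rintro e ⟨he, hea⟩
        rcases mem_insert.1 he with rfl | he
        · exact absurd (huniq a ha hea.symm) hab
        · exact hc' e ⟨he, hea⟩
    · rintro v ⟨a, ha, rfl⟩
      by_cases hab : a = b
      · subst hab
        exact .head ⟨a, mem_insert_self _ _, rfl, rfl⟩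
          (reflTransGen_mono_arcs (subset_insert _ _) htb)
      · exact reflTransGen_mono_arcs (subset_insert _ _)
          (h3 _ ⟨a, mem_erase.2 ⟨hab, ha⟩, rfl⟩)
  · intro T hT
    obtain ⟨hTS, h1, h2, h3⟩ := mem_trees.1 hT
    have hbT : b ∈ T := by
      obtain ⟨a, ⟨ha, hab⟩, -⟩ := h2 (s b) ⟨b, hb, rfl⟩ hbr
      rwa [← huniq a (hTS ha) hab]
    have hne : ∀ a ∈ S.erase b, s a ≠ s b := fun a ha hab =>
      (mem_erase.1 ha).1 (huniq a (mem_erase.1 ha).2 hab)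
    refine mem_trees.2 ⟨erase_subset_erase _ hTS, fun a ha => h1 a (mem_of_mem_erase ha), ?_, ?_⟩
    · rintro v ⟨a, ha, rfl⟩ hvr
      obtain ⟨c, ⟨hc, hca⟩, hc'⟩ := h2 (s a) ⟨a, mem_of_mem_erase ha, rfl⟩ hvr
      refine ⟨c, ⟨mem_erase.2 ⟨?_, hc⟩, hca⟩, fun e he => hc' e ⟨mem_of_mem_erase he.1, he.2⟩⟩
      rintro rfl
      exact hne a ha hca.symm
    · rintro v ⟨a, ha, rfl⟩
      have h4 := h3 (s a) ⟨a, mem_of_mem_erase ha, rfl⟩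
      rw [← insert_erase hbT] at h4
      exact (reflTransGen_of_insert (fun c hc => hin c (hTS (mem_of_mem_erase hc))) (hin b hb)
        (hne a ha) h4).1
  · intro T hT
    refine erase_insert fun hbT => ?_
    simpa using (mem_trees.1 hT).1 hbT
  · intro T hT
    obtain ⟨hTS, h1, h2, h3⟩ := mem_trees.1 hT
    refine insert_erase ?_
    obtain ⟨a, ⟨ha, hab⟩, -⟩ := h2 (s b) ⟨b, hb, rfl⟩ hbr
    rwa [← huniq a (hTS ha) hab]

theorem trees_eq_empty {S : Finset E} (hS : S.Nonempty) {r : V}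
    (hs : fiberCard s S r = 0) (ht : fiberCard t S r = 0) : trees s t S r = ∅ := by
  rw [eq_empty_iff_forall_notMem]
  intro T hT
  obtain ⟨hTS, h1, h2, h3⟩ := mem_trees.1 hT
  obtain ⟨a, ha⟩ := hS
  rcases Relation.ReflTransGen.cases_tail (h3 (s a) ⟨a, ha, rfl⟩) with h | ⟨c, -, b, hb, -, hbr⟩
  · exact (fiberCard_pos.2 ⟨a, ha, h.symm⟩).ne' hs
  · exact (fiberCard_pos.2 ⟨b, hTS hb, hbr⟩).ne' ht

theorem card_trees_empty (r : V) : (trees s t ∅ r).card = 1 := by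
  simp [trees, IsTree, filter_singleton]

/-- The number of Euler trails from `v` to `r`, in terms of the spanning trees rooted at `r`. -/
theorem card_trails_eq [Fintype V] (S : Finset E) (v r : V) (hbal : Balanced s t S v r) :
    (trails s t S v r).card = (trees s t S r).card * ((fiberCard s S r).factorial *
      ∏ w ∈ univ.erase r, (fiberCard s S w - 1).factorial) := by
  induction S using Finset.strongInduction generalizing v with
  | H S ih =>
  rcases S.eq_empty_or_nonempty with rfl | hS
  · rw [card_trails_empty, card_trees_empty]
    have := hbal r
    simp [fiberCard] at this
    rw [if_pos this]
    simp [fiberCard]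
  rw [card_trails hS]
  have hih : ∀ b ∈ S.filter fun a => s a = v, (trails s t (S.erase b) (t b) r).card =
      (trees s t (S.erase b) r).card * ((fiberCard s (S.erase b) r).factorial *
        ∏ w ∈ univ.erase r, (fiberCard s (S.erase b) w - 1).factorial) := by
    intro b hb
    rw [mem_filter] at hb
    obtain ⟨hb, rfl⟩ := hb
    exact ih _ (erase_ssubset hb) _ (hbal.erase hb)
  rw [sum_congr rfl hih]
  by_cases hvr : v = r
  · subst hvr
    -- If no arc leaves `r`, balance says that none enters it either. The remaining arcs cannot be
    -- reached from `r`, so there are neither trails nor trees.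
    rcases Nat.eq_zero_or_pos (fiberCard s S v) with h0 | hpos
    · have h1 := hbal v
      rw [trees_eq_empty hS h0 (by omega), card_empty, zero_mul,
        card_eq_zero.1 h0, sum_empty]
    · have : ∀ b ∈ S.filter fun a => s a = v, (trees s t (S.erase b) v).card *
          ((fiberCard s (S.erase b) v).factorial *
            ∏ w ∈ univ.erase v, (fiberCard s (S.erase b) w - 1).factorial) =
          (trees s t S v).card * ((fiberCard s S v - 1).factorial *
            ∏ w ∈ univ.erase v, (fiberCard s S w - 1).factorial) := by
        intro b hb
        rw [mem_filter] at hb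
        obtain ⟨hb, rfl⟩ := hb
        congr 2
        · ext T
          exact mem_trees_erase_of_src_eq_root
        · rw [fiberCard_erase s hb (s b), if_pos rfl, Nat.add_sub_cancel]
        · refine prod_congr rfl fun w hw => ?_
          rw [fiberCard_erase s hb w, if_neg (ne_of_mem_erase hw).symm, add_zero]
      rw [sum_congr rfl this, sum_const, smul_eq_mul]
      change fiberCard s S v * _ = _
      rw [← Nat.mul_factorial_pred hpos.ne']
      ring
  · have hpos : 0 < fiberCard s S v := by
      have := hbal v
      rw [if_neg (Ne.symm hvr), if_pos rfl] at this
      omega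
    have hmem : v ∈ univ.erase r := by simp [hvr]
    have : ∀ b ∈ S.filter fun a => s a = v, (trees s t (S.erase b) r).card *
          ((fiberCard s (S.erase b) r).factorial *
            ∏ w ∈ univ.erase r, (fiberCard s (S.erase b) w - 1).factorial) =
          (trees s t (S.erase b) r).card * ((fiberCard s S r).factorial *
            ((fiberCard s S v - 1 - 1).factorial *
            ∏ w ∈ (univ.erase r).erase v, (fiberCard s S w - 1).factorial)) := by
      intro b hb
      rw [mem_filter] at hb
      obtain ⟨hb, rfl⟩ := hb
      congr 2
      · rw [fiberCard_erase s hb r, if_neg hvr, add_zero]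
      · rw [← mul_prod_erase _ _ hmem]
        congr 1
        · rw [fiberCard_erase s hb (s b), if_pos rfl, Nat.add_sub_cancel]
        · refine prod_congr rfl fun w hw => ?_
          rw [fiberCard_erase s hb w, if_neg (ne_of_mem_erase hw).symm, add_zero]
    rw [sum_congr rfl this, ← sum_mul, ← mul_prod_erase _ _ hmem]
    -- With a single arc out of `v` the first step is forced and the arc is a leaf of every tree.
    -- Otherwise the sum contributes the factor `outdegree - 1` that completes the factorial at `v`.
    rcases Nat.lt_or_ge (fiberCard s S v) 2 with h1 | h2
    · have h1 : fiberCard s S v = 1 := by omega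
      obtain ⟨b, hb⟩ := card_eq_one.1 (show (S.filter fun a => s a = v).card = 1 from h1)
      have hb' : b ∈ S.filter fun a => s a = v := by rw [hb]; simp
      obtain ⟨hbS, rfl⟩ := mem_filter.1 hb'
      rw [hb, sum_singleton, card_trees_erase_leaf hbS hvr hbal h1, h1]
    · rw [sum_card_trees_erase hvr h2, ← Nat.mul_factorial_pred (n := fiberCard s S v - 1) (by omega)]
      ring

end ArcTrail

/-! ### Euler tours and the BEST theorem -/

namespace ArcTrail

variable {E V : Type*} {s t : E → V}

/-- This unrolled form places the heads, preceded by `v`, against the tails, followed by `r`. The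
shift by one is what identifies a closed trail with a condition on `finRotate`. -/
theorem isTrail_ofFn {m : ℕ} (g : Fin m → E) (v r : V) :
    IsTrail s t v (List.ofFn g) r ↔ ∀ i : Fin (m + 1),
      (Fin.cons v (t ∘ g) : Fin (m + 1) → V) i = (Fin.snoc (s ∘ g) r : Fin (m + 1) → V) i := by
  induction m generalizing v with
  | zero => simp [IsTrail, Fin.snoc]
  | succ m ih =>
    rw [List.ofFn_succ, Fin.forall_fin_succ]
    simp only [IsTrail, Fin.cons_zero, Fin.cons_succ]
    have h0 : (Fin.snoc (s ∘ g) r : Fin (m + 1 + 1) → V) 0 = s (g 0) :=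
      Fin.snoc_castSucc (α := fun _ => V) (n := m + 1) r (s ∘ g) 0
    have h1 : ∀ i : Fin (m + 1), (Fin.snoc (s ∘ g) r : Fin (m + 1 + 1) → V) i.succ =
        (Fin.snoc (s ∘ fun i => g i.succ) r : Fin (m + 1) → V) i := by
      intro i
      refine Fin.lastCases ?_ (fun i => ?_) i
      · rw [Fin.succ_last, Fin.snoc_last, Fin.snoc_last]
      · rw [Fin.succ_castSucc, Fin.snoc_castSucc, Fin.snoc_castSucc]
        rfl
    have h2 : ∀ i : Fin (m + 1), (t ∘ g) i =
        (Fin.cons (t (g 0)) (t ∘ fun i => g i.succ) : Fin (m + 1) → V) i := by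
      intro i
      refine Fin.cases ?_ (fun i => ?_) i <;> simp
    rw [h0, ih, eq_comm]
    simp only [h1, h2]

variable (s t) in
/-- The Euler tours, with a distinguished starting point. -/
noncomputable def tours [Fintype E] (N : ℕ) : Finset (Fin N ≃ E) :=
  univ.filter fun e => ∀ m, t (e m) = s (e (finRotate N m))

theorem mem_tours [Fintype E] {N : ℕ} {e : Fin N ≃ E} :
    e ∈ tours s t N ↔ ∀ m, t (e m) = s (e (finRotate N m)) := by
  simp [tours]

theorem mem_tours_iff_isTrail [Fintype E] {M : ℕ} (e : Fin (M + 1) ≃ E) :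
    e ∈ tours s t (M + 1) ↔
      IsTrail s t (t (e 0)) (List.ofFn fun i : Fin M => e i.succ) (s (e 0)) := by
  rw [mem_tours, isTrail_ofFn, Fin.snoc_eq_cons_rotate]
  have h : ∀ (g : E → V) (i : Fin (M + 1)),
      (Fin.cons (g (e 0)) (g ∘ fun i : Fin M => e i.succ) : Fin (M + 1) → V) i = g (e i) := by
    intro g i
    refine Fin.cases ?_ (fun i => ?_) i <;> simp
  simp only [h]

theorem card_tours_starting [Fintype E] {M : ℕ} (hE : Fintype.card E = M + 1) (a : E) :
    ((tours s t (M + 1)).filter fun e => e 0 = a).card =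
      (trails s t (univ.erase a) (t a) (s a)).card := by
  refine card_bij (fun e _ => List.ofFn fun i : Fin M => e i.succ) ?_ ?_ ?_
  · intro e he
    rw [mem_filter, mem_tours_iff_isTrail] at he
    obtain ⟨he, rfl⟩ := he
    refine mem_trails.2 ⟨⟨?_, ?_⟩, he⟩
    · exact List.nodup_ofFn.2 (e.injective.comp (Fin.succ_injective _))
    · ext b
      simp only [List.mem_toFinset, List.mem_ofFn, mem_erase, mem_univ, and_true]
      constructor
      · rintro ⟨i, rfl⟩ h
        exact Fin.succ_ne_zero i (e.injective h)
      · intro h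
        obtain ⟨i, hi⟩ := (Fin.exists_succ_eq (x := e.symm b)).2 fun h0 => h (by rw [← h0]; simp)
        exact ⟨i, by simp [hi]⟩
  · intro e he e' he' h
    rw [mem_filter] at he he'
    have h := List.ofFn_injective h
    ext i
    refine Fin.cases ?_ (fun i => ?_) i
    · rw [he.2, he'.2]
    · exact congrFun h i
  · intro l hl
    obtain ⟨⟨h1, h2⟩, h3⟩ := mem_trails.1 hl
    have hlen : l.length = M := by
      rw [← List.toFinset_card_of_nodup h1, h2, card_erase_of_mem (mem_univ a), card_univ, hE,
        Nat.add_sub_cancel]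
    subst hlen
    have hal : a ∉ l := by
      rw [← List.mem_toFinset, h2]
      simp
    have hinj : Function.Injective (Fin.cons a l.get : Fin (l.length + 1) → E) := by
      rw [Fin.cons_injective_iff]
      refine ⟨?_, List.nodup_iff_injective_get.1 h1⟩
      rwa [Set.range_list_get]
    have hbij := (Fintype.bijective_iff_injective_and_card _).2 ⟨hinj, by simp [hE]⟩
    have hs : (List.ofFn fun i : Fin l.length => Equiv.ofBijective _ hbij i.succ) = l := by
      simp
    refine ⟨Equiv.ofBijective _ hbij, ?_, hs⟩
    rw [mem_filter, mem_tours_iff_isTrail, hs]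
    exact ⟨h3, rfl⟩

theorem card_tours_rotate [Fintype E] {N : ℕ} (a : E) (m : Fin N) :
    ((tours s t N).filter fun e => e (finRotate N m) = a).card =
      ((tours s t N).filter fun e => e m = a).card := by
  refine card_bij' (fun e _ => (finRotate N).trans e) (fun e _ => (finRotate N).symm.trans e)
    ?_ ?_ ?_ ?_
  · intro e he
    simp only [mem_filter, mem_tours] at he ⊢
    exact ⟨fun m => he.1 _, he.2⟩
  · intro e he
    simp only [mem_filter, mem_tours, Equiv.trans_apply, Equiv.symm_apply_apply] at he ⊢
    refine ⟨fun m => ?_, he.2⟩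
    have := he.1 ((finRotate N).symm m)
    rwa [Equiv.apply_symm_apply] at this
  · intro e _
    exact Equiv.ext fun i => by simp only [Equiv.trans_apply, Equiv.apply_symm_apply]
  · intro e _
    exact Equiv.ext fun i => by simp only [Equiv.trans_apply, Equiv.symm_apply_apply]

theorem card_tours_through [Fintype E] {M : ℕ} (a : E) (m : Fin (M + 1)) :
    ((tours s t (M + 1)).filter fun e => e m = a).card =
      ((tours s t (M + 1)).filter fun e => e 0 = a).card := by
  induction m using Fin.induction with
  | zero => rfl
  | succ i ih =>
    rw [← ih, ← card_tours_rotate a i.castSucc, finRotate_apply, Fin.coeSucc_eq_succ]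

/-- A tour passes through `a` at exactly one of its `M + 1` positions, and by rotation each position
accounts for equally many tours. -/
theorem card_tours [Fintype E] {M : ℕ} (a : E) :
    (tours s t (M + 1)).card =
      (M + 1) * ((tours s t (M + 1)).filter fun e => e 0 = a).card := by
  rw [card_eq_sum_card_fiberwise (t := univ) (f := fun e => e.symm a) (by intro; simp)]
  simp only [Equiv.symm_apply_eq, eq_comm (a := a), card_tours_through a]
  simp

theorem card_tours_eq_sum_trails [Fintype E] [Fintype V] {M : ℕ} (hE : Fintype.card E = M + 1) :
    (tours s t (M + 1)).card = ∑ v, (trails s t univ v v).card := by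
  have : Nonempty E := Fintype.card_pos_iff.1 (by omega)
  rw [card_eq_sum_card_fiberwise (t := univ) (f := fun e => e 0) (by intro; simp)]
  simp only [card_tours_starting hE, card_trails univ_nonempty]
  rw [← sum_fiberwise univ s]
  refine sum_congr rfl fun v _ => sum_congr rfl fun a ha => ?_
  rw [(mem_filter.1 ha).2]

/-- The successor map of the tour is a bijection of the arcs that carries those ending at `w` to
those starting at `w`. -/
theorem fiberCard_eq_of_mem_tours [Fintype E] {N : ℕ} {e : Fin N ≃ E} (he : e ∈ tours s t N)
    (w : V) : fiberCard s univ w = fiberCard t univ w := by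
  refine (card_equiv ((e.symm.trans (finRotate N)).trans e) fun a => ?_).symm
  have := mem_tours.1 he (e.symm a)
  rw [Equiv.apply_symm_apply] at this
  simp [this]

/-- The BEST theorem. -/
theorem card_tours_eq_card_trees [Fintype E] [Fintype V] {M : ℕ} (hE : Fintype.card E = M + 1)
    (hne : (tours s t (M + 1)).Nonempty) (a : E) :
    (tours s t (M + 1)).card = (M + 1) * ((trees s t univ (s a)).card *
      ∏ w, (fiberCard s univ w - 1).factorial) := by
  obtain ⟨e, he⟩ := hne
  have hbal : Balanced s t univ (s a) (s a) := fun w => by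
    rw [fiberCard_eq_of_mem_tours he]
  -- Once `a` is fixed as first arc, the rest is a trail to `s a` that lacks one arc out of `s a`.
  -- The full factorial at the root thereby becomes `(outdegree - 1)!`, as at all other vertices.
  rw [card_tours a, card_tours_starting hE, card_trails_eq _ _ _ (hbal.erase (mem_univ a)),
    ← mul_prod_erase univ _ (mem_univ (s a))]
  congr 3
  · ext T
    exact mem_trees_erase_of_src_eq_root
  · rw [fiberCard_erase s (mem_univ a) (s a), if_pos rfl, Nat.add_sub_cancel]
  · refine prod_congr rfl fun w hw => ?_
    rw [fiberCard_erase s (mem_univ a) w, if_neg (ne_of_mem_erase hw).symm, add_zero]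

end ArcTrail

/-! ### Polynomials acting as differential operators -/

namespace MvPolynomial

variable {σ R : Type*} [CommRing R]

/-- The commutator of two derivations is a derivation, and this one kills all variables. -/
theorem pderiv_comm (a b : σ) (p : MvPolynomial σ R) :
    pderiv a (pderiv b p) = pderiv b (pderiv a p) := by
  have h : ⁅(pderiv a : Derivation R (MvPolynomial σ R) (MvPolynomial σ R)), (pderiv b : Derivation R (MvPolynomial σ R) (MvPolynomial σ R))⁆ = 0 := by
    refine derivation_ext fun c => ?_
    rw [Derivation.commutator_apply, pderiv_X, pderiv_X]
    simp [Pi.single_apply, apply_ite (pderiv a), apply_ite (pderiv b)]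
  have := congrArg (fun D => D p) h
  simpa [Derivation.commutator_apply, sub_eq_zero] using this

open scoped IsMulCommutative in
/-- Substituting `∂/∂x_s` for `x_s` is multiplicative. -/
theorem exists_algHom_pderiv (σ R : Type*) [CommRing R] :
    ∃ D : MvPolynomial σ R →ₐ[R] Module.End R (MvPolynomial σ R), ∀ a, D (X a) =
      ((pderiv a : Derivation R (MvPolynomial σ R) (MvPolynomial σ R)) :
        Module.End R (MvPolynomial σ R)) := by
  let S : Set (Module.End R (MvPolynomial σ R)) := Set.range fun a =>
    ((pderiv a : Derivation R (MvPolynomial σ R) (MvPolynomial σ R)) :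
      Module.End R (MvPolynomial σ R))
  have hS : ∀ a ∈ S, ∀ b ∈ S, a * b = b * a := by
    rintro _ ⟨a, rfl⟩ _ ⟨b, rfl⟩
    exact LinearMap.ext fun p => pderiv_comm a b p
  -- `aeval` needs a commutative target: the subalgebra generated by the partial derivatives, which
  -- is afterwards included in all endomorphisms.
  have := Algebra.isMulCommutative_adjoin R hS
  refine ⟨(Algebra.adjoin R S).val.comp
    (aeval fun a => ⟨_, Algebra.subset_adjoin (Set.mem_range_self a)⟩), fun a => ?_⟩
  rw [AlgHom.comp_apply, aeval_X]
  rfl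

/-- The differential operator with constant coefficients that a polynomial defines. -/
noncomputable def toDiffOp : MvPolynomial σ R →ₐ[R] Module.End R (MvPolynomial σ R) :=
  (exists_algHom_pderiv σ R).choose

theorem toDiffOp_X (a : σ) : toDiffOp (X a) =
    ((pderiv a : Derivation R (MvPolynomial σ R) (MvPolynomial σ R)) :
      Module.End R (MvPolynomial σ R)) :=
  (exists_algHom_pderiv σ R).choose_spec a

theorem toDiffOp_X_apply (a : σ) (p : MvPolynomial σ R) : toDiffOp (X a) p = pderiv a p := by
  rw [toDiffOp_X]
  rfl

/-- The Weyl relation: the commutator of `q(∂)` with multiplication by `x_a` is `(∂q/∂x_a)(∂)`.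
Under `constantCoeff` only this commutator survives. -/
theorem toDiffOp_X_mul (q p : MvPolynomial σ R) (a : σ) :
    toDiffOp q (X a * p) = X a * toDiffOp q p + toDiffOp (pderiv a q) p := by
  induction q using MvPolynomial.induction_on generalizing p with
  | C c =>
    rw [pderiv_C, map_zero, ← algebraMap_eq, AlgHom.commutes]
    simp [Module.algebraMap_end_apply]
  | add q q' h h' =>
    simp only [map_add, LinearMap.add_apply, h, h']
    ring
  | mul_X q b h =>
    rw [map_mul toDiffOp, Module.End.mul_apply, Module.End.mul_apply, toDiffOp_X_apply, toDiffOp_X_apply,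
      Derivation.leibniz, Derivation.leibniz, pderiv_X, pderiv_X, smul_eq_mul, smul_eq_mul,
      smul_eq_mul, smul_eq_mul, map_add, map_add, h, LinearMap.add_apply, mul_comm (X b),
      map_mul toDiffOp (pderiv a q), Module.End.mul_apply, toDiffOp_X_apply]
    by_cases hab : a = b
    · subst hab
      simp
      ring
    · simp [hab, Ne.symm hab]

theorem pderiv_prod_X {E : Type*} (S : Finset E) (ε : E → σ) (a : σ) :
    pderiv a (∏ e ∈ S, (X (ε e) : MvPolynomial σ R)) =
      ∑ b ∈ S.filter fun b => ε b = a, ∏ e ∈ S.erase b, X (ε e) := by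
  rw [sum_filter]
  induction S using Finset.induction_on with
  | empty => simp
  | insert c S hc ih =>
    rw [prod_insert hc, Derivation.leibniz, ih, sum_insert hc, erase_insert hc, pderiv_X, add_comm,
      smul_eq_mul, smul_eq_mul, mul_sum]
    congr 1
    · by_cases h : ε c = a <;> simp [h]
    · refine sum_congr rfl fun b hb => ?_
      have hcb : c ≠ b := fun h => hc (h ▸ hb)
      rw [erase_insert_of_ne hcb, prod_insert fun h => hc (mem_of_mem_erase h), mul_ite, mul_zero]

end MvPolynomial

/-! ### Differentiating matrix powers counts trails -/

namespace ArcTrail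

open MvPolynomial

variable {E V : Type*} {s t : E → V} [Fintype V] [DecidableEq V]

/-- Peeling off the first factor of the power of `X` differentiates the arc monomial by `x_{vw}`,
that is, deletes one arc from `v` to `w`. Summing over `w` gives the recursion of `card_trails`. -/
theorem constantCoeff_toDiffOp_prod_X {R : Type*} [CommRing R] (m : ℕ) (S : Finset E)
    (hS : S.card = m) (v r : V) :
    constantCoeff (toDiffOp (∏ a ∈ S, X (s a, t a)) ((Matrix.mvPolynomialX V V R ^ m) v r)) =
      ((trails s t S v r).card : R) := by
  induction m generalizing S v with
  | zero =>
    rw [card_eq_zero.1 hS, card_trails_empty]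
    by_cases h : v = r <;> simp [h]
  | succ m ih =>
    rw [pow_succ', Matrix.mul_apply, map_sum, map_sum, card_trails (card_pos.1 (by omega))]
    simp only [Matrix.mvPolynomialX_apply, toDiffOp_X_mul, map_add, map_mul, constantCoeff_X,
      zero_mul, zero_add, pderiv_prod_X, map_sum, LinearMap.sum_apply]
    push_cast
    conv_rhs => rw [← sum_fiberwise _ t]
    refine sum_congr rfl fun w _ => ?_
    refine sum_congr (by ext; simp [and_assoc]) fun b hb => ?_
    simp only [mem_filter] at hb
    rw [ih _ (by rw [card_erase_of_mem hb.1.1, hS, Nat.add_sub_cancel]), hb.2]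

theorem constantCoeff_toDiffOp_trace {R : Type*} [CommRing R] [Fintype E] {M : ℕ}
    (hE : Fintype.card E = M + 1) :
    constantCoeff (toDiffOp (∏ a, X (s a, t a))
      (Matrix.trace (Matrix.mvPolynomialX V V R ^ (M + 1)))) = ((tours s t (M + 1)).card : R) := by
  rw [card_tours_eq_sum_trails hE, Matrix.trace, map_sum, map_sum, Nat.cast_sum]
  exact sum_congr rfl fun v _ => constantCoeff_toDiffOp_prod_X _ _ hE v v

end ArcTrail

/-! ### The trace as a sum over ordered sequences of multi-indices -/

/-- Monotone words correspond to the tuples of the multiplicities of their letters. -/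
theorem sum_piAntidiag_eq_sum_monotone {M : Type*} [AddCommMonoid M] (n d : ℕ)
    (h : (Fin n → ℕ) → M) :
    ∑ m ∈ piAntidiag (univ : Finset (Fin n)) d, h m =
      ∑ ι ∈ univ.filter fun ι : Fin d → Fin n => Monotone ι,
        h fun i => (univ.filter fun j => ι j = i).card := by
  have hcount : ∀ (ι : Fin d → Fin n) (i : Fin n),
      (List.ofFn ι).count i = (univ.filter fun j => ι j = i).card := by
    intro ι i
    rw [← Multiset.coe_count, ← Fin.univ_val_map, Multiset.count_map]
    simp only [eq_comm (a := i)]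
    rfl
  symm
  refine sum_bij (fun ι _ i => (univ.filter fun j => ι j = i).card) ?_ ?_ ?_ fun _ _ => rfl
  · intro ι _
    rw [mem_piAntidiag]
    refine ⟨?_, fun _ _ => mem_univ _⟩
    rw [← card_eq_sum_card_fiberwise (fun _ _ => mem_univ _), card_univ, Fintype.card_fin]
  · intro ι hι ι' hι' heq
    have hperm : (List.ofFn ι).Perm (List.ofFn ι') := by
      rw [List.perm_iff_count]
      intro i
      rw [hcount, hcount]
      exact congrFun heq i
    have hsort : ∀ {ι : Fin d → Fin n}, Monotone ι → (List.ofFn ι).Pairwise (· ≤ ·) :=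
      fun h => (List.sortedLE_ofFn_iff.2 h).pairwise
    exact List.ofFn_injective
      (hperm.eq_of_pairwise' (hsort (mem_filter.1 hι).2) (hsort (mem_filter.1 hι').2))
  · intro m hm
    rw [mem_piAntidiag] at hm
    -- The monotone word with multiplicities `m` is the sorted list of this multiset.
    let S : Multiset (Fin n) := ∑ i, m i • {i}
    have hS : ∀ i, S.count i = m i := by
      intro i
      simp [S, Multiset.count_sum', Multiset.count_singleton]
    have hlen : (S.sort (· ≤ ·)).length = d := by
      rw [Multiset.length_sort, ← hm.1]
      simp [S]
    generalize hl : S.sort (· ≤ ·) = l at hlen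
    subst hlen
    refine ⟨l.get, ?_, ?_⟩
    · rw [mem_filter]
      refine ⟨mem_univ _, List.sortedLE_ofFn_iff.1 ?_⟩
      rw [List.ofFn_get, ← hl]
      exact (Multiset.pairwise_sort S _).sortedLE
    · funext i
      rw [← hcount, List.ofFn_get, ← hl, ← Multiset.coe_count, Multiset.sort_eq, hS]

theorem IndexSeq.sum_isOrdered {M : Type*} [AddCommMonoid M] {d k n : ℕ}
    (F : IndexSeq d k n → M) :
    ∑ f ∈ univ.filter fun f : IndexSeq d k n => f.IsOrdered, F f =
      ∑ ι ∈ univ.filter fun ι : Fin d → Fin n => Monotone ι,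
        ∑ β : Fin d → Fin (k - 1) → Fin n, F fun j => (ι j, β j) := by
  rw [sum_filter, sum_filter, ← (Equiv.arrowProdEquivProdArrow (Fin d) _ _).symm.sum_comp,
    Fintype.sum_prod_type]
  refine sum_congr rfl fun ι _ => ?_
  by_cases h : Monotone ι
  · rw [if_pos h]
    exact sum_congr rfl fun β _ => if_pos h
  · rw [if_neg h]
    exact sum_eq_zero fun β _ => if_neg h

/-- Each term with first letter `v` contributes `k - 1` arcs. Thus the normalisation `1/(m_i(k-1))!`
of the trace is `1/d⁺(i)!`. -/
theorem IndexSeq.outDegree_eq {d k n : ℕ} (f : IndexSeq d k n) (v : Fin n) :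
    f.outDegree v = (univ.filter fun j => (f j).1 = v).card * (k - 1) := by
  have : (univ.filter fun a : Arc d k => f.src a = v) =
      (univ.filter fun j => (f j).1 = v) ×ˢ univ := by
    ext a
    rw [mem_filter, mem_product, mem_filter]
    simp [src]
  rw [outDegree, this, card_product, card_univ, Fintype.card_fin]

theorem IndexSeq.fiberCard_src {d k n : ℕ} (f : IndexSeq d k n) (v : Fin n) :
    ArcTrail.fiberCard f.src univ v = f.outDegree v := by
  unfold ArcTrail.fiberCard outDegree
  congr

namespace Tensor

open MvPolynomial

/-- The polynomial `∑_β a_{iβ} x_{iβ}`. -/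
noncomputable def rowPoly {k n : ℕ} (A : Tensor k n) (i : Fin n) :
    MvPolynomial (Fin n × Fin n) ℂ :=
  ∑ β : Fin (k - 1) → Fin n, A i β • ∏ l, X (i, β l)

theorem diffOp_eq {k n : ℕ} (A : Tensor k n) (i : Fin n) :
    A.diffOp i = toDiffOp (A.rowPoly i) := by
  simp only [diffOp, rowPoly, map_sum, map_smul]
  refine sum_congr rfl fun β _ => ?_
  rw [← List.prod_ofFn, map_list_prod, List.map_ofFn]
  congr
  funext l
  simp [toDiffOp_X]

theorem prod_rowPoly {d k n : ℕ} (A : Tensor k n) (ι : Fin d → Fin n) :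
    ∏ j, A.rowPoly (ι j) = ∑ β : Fin d → Fin (k - 1) → Fin n,
      IndexSeq.tensorProd (fun j => (ι j, β j)) A •
        ∏ a, X (IndexSeq.src (fun j => (ι j, β j) : IndexSeq d k n) a,
          IndexSeq.tgt (fun j => (ι j, β j) : IndexSeq d k n) a) := by
  unfold rowPoly
  rw [prod_univ_sum, Fintype.piFinset_univ]
  refine sum_congr rfl fun β _ => ?_
  rw [Fintype.prod_prod_type, prod_smul]
  rfl

theorem trace_eq_sum_tours {d k n : ℕ} (hk : 2 ≤ k) (hd : 1 ≤ d) (A : Tensor k n) :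
    A.trace d = ((k - 1 : ℕ) : ℂ) ^ (n - 1) *
      ∑ f ∈ univ.filter fun f : IndexSeq d k n => f.IsOrdered,
        (∏ v, ((f.outDegree v).factorial : ℂ)⁻¹) * (f.tensorProd A *
          ((ArcTrail.tours f.src f.tgt (d * (k - 1))).card : ℂ)) := by
  obtain ⟨M, hM⟩ : ∃ M, d * (k - 1) = M + 1 :=
    Nat.exists_eq_succ_of_ne_zero (Nat.mul_pos hd (by omega)).ne'
  rw [trace, sum_piAntidiag_eq_sum_monotone, IndexSeq.sum_isOrdered]
  congr 1
  refine sum_congr rfl fun ι _ => ?_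
  have h1 : (List.ofFn fun i : Fin n =>
      ((((univ.filter fun j => ι j = i).card * (k - 1)).factorial : ℂ)⁻¹ •
        A.diffOp i ^ (univ.filter fun j => ι j = i).card)).prod =
      toDiffOp ((∏ i, (((univ.filter fun j => ι j = i).card * (k - 1)).factorial : ℂ)⁻¹) •
        ∏ j, A.rowPoly (ι j)) := by
    rw [← prod_fiberwise univ ι, ← prod_smul, ← List.prod_ofFn, map_list_prod, List.map_ofFn]
    congr 2
    funext i
    rw [Function.comp_apply, map_smul, diffOp_eq, ← map_pow, prod_congr rfl
      (g := fun _ => A.rowPoly i), prod_const]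
    intro j hj
    rw [(mem_filter.1 hj).2]
  rw [h1, prod_rowPoly, smul_sum, map_sum, LinearMap.sum_apply, map_sum]
  refine sum_congr rfl fun β _ => ?_
  simp only [map_smul, LinearMap.smul_apply, constantCoeff_smul, smul_eq_mul]
  rw [hM, ArcTrail.constantCoeff_toDiffOp_trace (by simp [hM])]
  simp only [IndexSeq.outDegree_eq]

end Tensor

/-! ### The weight of a sequence with an Euler tour -/

namespace IndexSeq

variable {d k n : ℕ} {f : IndexSeq d k n}

theorem hasEulerTour_iff :
    f.HasEulerTour ↔ (ArcTrail.tours f.src f.tgt (d * (k - 1))).Nonempty := by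
  simp [HasEulerTour, ArcTrail.tours, Finset.Nonempty]

/-- On a tour each head is the tail of the next arc. Hence the trees of `ArcTrail`, whose conditions
range over tails only, are the spanning trees on `V(f)`. -/
theorem HasEulerTour.mem_verts (hf : f.HasEulerTour) (hk : 2 ≤ k) {v : Fin n} :
    v ∈ f.verts ↔ ∃ a, f.src a = v := by
  obtain ⟨e, he⟩ := hf
  simp only [verts, mem_biUnion, mem_univ, true_and, MultiIndex.support, mem_insert, mem_image]
  constructor
  · rintro ⟨j, rfl | ⟨l, rfl⟩⟩
    · exact ⟨(j, ⟨0, by omega⟩), rfl⟩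
    · have := he (e.symm (j, l))
      rw [Equiv.apply_symm_apply] at this
      exact ⟨_, this.symm⟩
  · rintro ⟨a, rfl⟩
    exact ⟨a.1, Or.inl rfl⟩

theorem HasEulerTour.tau_eq (hf : f.HasEulerTour) (hk : 2 ≤ k) (r : Fin n) :
    f.tau r = (ArcTrail.trees f.src f.tgt univ r).card := by
  unfold tau
  congr 1
  ext T
  simp [ArcTrail.mem_trees, ArcTrail.IsTree, IsRootedSpanningTree, hf.mem_verts hk]

theorem HasEulerTour.card_tours (hf : f.HasEulerTour) (hk : 2 ≤ k) (hd : 1 ≤ d) {r : Fin n}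
    (hr : r ∈ f.verts) :
    (∏ v, ((f.outDegree v).factorial : ℂ)⁻¹) *
        ((ArcTrail.tours f.src f.tgt (d * (k - 1))).card : ℂ) =
      (d : ℂ) * ((k - 1 : ℕ) : ℂ) * (f.tau r / ∏ v ∈ f.verts, (f.outDegree v : ℂ)) := by
  obtain ⟨M, hM⟩ : ∃ M, d * (k - 1) = M + 1 :=
    Nat.exists_eq_succ_of_ne_zero (Nat.mul_pos hd (by omega)).ne'
  obtain ⟨a, rfl⟩ := (hf.mem_verts hk).1 hr
  have hne := hasEulerTour_iff.1 hf
  rw [hM] at hne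
  have hdeg : ∀ v, v ∈ f.verts ↔ 0 < f.outDegree v := by
    intro v
    rw [hf.mem_verts hk, ← fiberCard_src, ArcTrail.fiberCard_pos]
    simp
  have hprod : ∏ v, ((f.outDegree v).factorial : ℂ) =
      (∏ v, ((f.outDegree v - 1).factorial : ℂ)) * ∏ v ∈ f.verts, (f.outDegree v : ℂ) := by
    rw [← prod_subset (subset_univ f.verts) (f := fun v => ((f.outDegree v).factorial : ℂ)),
      ← prod_subset (subset_univ f.verts) (f := fun v => ((f.outDegree v - 1).factorial : ℂ)),
      ← prod_mul_distrib]
    · refine prod_congr rfl fun v hv => ?_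
      rw [← Nat.mul_factorial_pred ((hdeg v).1 hv).ne']
      push_cast
      ring
    · intro v _ hv
      have : f.outDegree v = 0 := by simpa [hdeg] using hv
      simp [this]
    · intro v _ hv
      have : f.outDegree v = 0 := by simpa [hdeg] using hv
      simp [this]
  have hM' : (d : ℂ) * ((k - 1 : ℕ) : ℂ) = ((M + 1 : ℕ) : ℂ) := by
    rw [← hM, Nat.cast_mul]
  rw [prod_inv_distrib, hprod, hM, ArcTrail.card_tours_eq_card_trees (by simp [hM]) hne a,
    ← hf.tau_eq hk, hM']
  simp only [fiberCard_src]
  have h0 : ∏ v, ((f.outDegree v - 1).factorial : ℂ) ≠ 0 :=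
    prod_ne_zero_iff.2 fun v _ => Nat.cast_ne_zero.2 (Nat.factorial_ne_zero _)
  have h1 : ∏ v ∈ f.verts, (f.outDegree v : ℂ) ≠ 0 :=
    prod_ne_zero_iff.2 fun v hv => Nat.cast_ne_zero.2 ((hdeg v).1 hv).ne'
  push_cast
  field_simp

end IndexSeq

/-- The trace as a sum over the sequences of multi-indices with an Euler tour. -/
theorem Tensor.trace_eq_sum_tau {d k n : ℕ} (hk : 2 ≤ k) (hd : 1 ≤ d) (A : Tensor k n)
    (root : IndexSeq d k n → Fin n) (hroot : ∀ f, root f ∈ f.verts) :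
    A.trace d = (d : ℂ) * ((k - 1 : ℕ) : ℂ) ^ n *
      ∑ f ∈ univ.filter fun f : IndexSeq d k n => f.IsOrdered ∧ f.HasEulerTour,
        (f.tau (root f) : ℂ) * f.tensorProd A / ∏ v ∈ f.verts, (f.outDegree v : ℂ) := by
  rw [trace_eq_sum_tours hk hd, ← filter_filter]
  -- The exponent `n - 1` is truncated at `n = 0`; there both sums are empty because `d ≥ 1`.
  rcases Nat.eq_zero_or_pos n with rfl | hn
  · have : IsEmpty (IndexSeq d k 0) := ⟨fun f => (f ⟨0, hd⟩).1.elim0⟩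
    simp [univ_eq_empty]
  rw [sum_filter (p := fun f => IndexSeq.HasEulerTour f), mul_sum, mul_sum]
  refine sum_congr rfl fun f _ => ?_
  split_ifs with hf
  · rw [← mul_assoc (∏ v, _), mul_right_comm (∏ v, _), hf.card_tours hk hd (hroot f)]
    obtain ⟨n, rfl⟩ := Nat.exists_eq_succ_of_ne_zero hn.ne'
    simp only [Nat.succ_eq_add_one, Nat.add_sub_cancel, pow_succ]
    ring
  · rw [IndexSeq.hasEulerTour_iff, not_nonempty_iff_eq_empty] at hf
    simp [hf]

/-! ### Sequences of diagonal multi-indices and hyperedges -/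

/-- Going round the tour leads from any tail to any other, so symmetry of `R` is not needed. It is
applied with reachability along hyperedges and with equality. -/
theorem ArcTrail.rel_of_mem_tours {E V : Type*} [Fintype E] {s t : E → V} {N : ℕ} {e : Fin N ≃ E}
    (he : e ∈ tours s t N) {R : V → V → Prop} (hrefl : ∀ v, R v v)
    (htrans : ∀ u v w, R u v → R v w → R u w) (h : ∀ a, R (s a) (t a)) (a b : E) :
    R (s a) (s b) := by
  cases N with
  | zero => exact (e.symm a).elim0
  | succ M =>
    have hstep : ∀ m, R (s (e m)) (s (e (finRotate (M + 1) m))) := fun m => by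
      rw [← mem_tours.1 he m]
      exact h _
    have hsucc : ∀ m : Fin M, R (s (e m.castSucc)) (s (e m.succ)) := fun m => by
      have := hstep m.castSucc
      rwa [finRotate_apply, Fin.coeSucc_eq_succ] at this
    have h0 : ∀ m, R (s (e 0)) (s (e m)) := fun m => by
      induction m using Fin.induction with
      | zero => exact hrefl _
      | succ m ih => exact htrans _ _ _ ih (hsucc m)
    have h1 : ∀ m, R (s (e m)) (s (e 0)) := fun m => by
      induction m using Fin.reverseInduction with
      | last =>
        have := hstep (Fin.last M)
        rwa [finRotate_last] at this
      | cast m ih => exact htrans _ _ _ (hsucc m) ih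
    have := htrans _ _ _ (h1 (e.symm a)) (h0 (e.symm b))
    rwa [Equiv.apply_symm_apply, Equiv.apply_symm_apply] at this

namespace MultiIndex

variable {k n : ℕ}

/-- All letters of the multi-index are equal. -/
def IsDiag (x : MultiIndex k n) : Prop :=
  ∀ l, x.2 l = x.1

theorem IsDiag.card_support_ne {x : MultiIndex k n} (hx : x.IsDiag) (hk : 2 ≤ k) :
    x.support.card ≠ k := by
  have : x.support ⊆ {x.1} := by
    intro v hv
    rw [support, mem_insert, mem_image] at hv
    rcases hv with rfl | ⟨l, -, rfl⟩
    · simp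
    · simp [hx l]
  have := card_le_card this
  rw [card_singleton] at this
  omega

/-- A multi-index with `k` distinct letters has no repetition, so membership counts occurrences. -/
theorem ite_mem_support {x : MultiIndex k n} (hk : 2 ≤ k) (hx : x.support.card = k) (v : Fin n) :
    (if v ∈ x.support then 1 else 0) =
      (if x.1 = v then 1 else 0) + ∑ l, if x.2 l = v then 1 else 0 := by
  have hle : (univ.image x.2).card ≤ k - 1 := card_image_le.trans (by simp)
  have hnot : x.1 ∉ univ.image x.2 := by
    intro h
    rw [support, insert_eq_of_mem h] at hx
    omega
  have hinj : Function.Injective x.2 := by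
    rw [support, card_insert_of_notMem hnot] at hx
    rw [← Set.injOn_univ, ← coe_univ, ← card_image_iff, card_univ, Fintype.card_fin]
    omega
  by_cases hv : ∃ l, x.2 l = v
  · obtain ⟨l, rfl⟩ := hv
    have h1 : x.1 ≠ x.2 l := fun h => hnot (by rw [h]; simp)
    simp [support, h1, hinj.eq_iff]
  · have : ∀ l, x.2 l ≠ v := fun l h => hv ⟨l, h⟩
    simp [support, this, eq_comm]

end MultiIndex

namespace IndexSeq

variable {d k n : ℕ} {f : IndexSeq d k n}

theorem mem_hypergraph_edges {e : Finset (Fin n)} :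
    e ∈ f.hypergraph.edges ↔ ∃ j, (f j).support.card = k ∧ (f j).support = e := by
  simp [hypergraph]

/-- The degree of `v` counts its occurrences as first and as later letters of the hyperedge terms.
Indegree equals outdegree, and diagonal terms add the same to both, so the later letters equal to
`v` are `k - 1` times as many as the first letters. The degree is therefore `k` times the number of
hyperedge terms that start with `v`. -/
theorem HasEulerTour.dvd_degree (hf : f.HasEulerTour) (hk : 2 ≤ k)
    (hdiag : ∀ j, (f j).IsDiag ∨ (f j).support.card = k) (v : Fin n) :
    k ∣ f.hypergraph.degree v := by
  have hdeg : f.hypergraph.degree v =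
      ∑ j, if (f j).support.card = k ∧ v ∈ (f j).support then 1 else 0 := by
    rw [MultiHypergraph.degree, hypergraph, Multiset.countP_map, ← card_filter, ← filter_filter]
    rfl
  obtain ⟨e, he⟩ := hasEulerTour_iff.1 hf
  have hbal := ArcTrail.fiberCard_eq_of_mem_tours he v
  rw [ArcTrail.fiberCard, ArcTrail.fiberCard, card_filter, card_filter, Fintype.sum_prod_type,
    Fintype.sum_prod_type] at hbal
  have hsum : (∑ j, if (f j).support.card = k ∧ v ∈ (f j).support then 1 else 0) +
      (∑ j, ∑ _l : Fin (k - 1), if (f j).1 = v then 1 else 0) =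
      k * (∑ j, if (f j).support.card = k ∧ (f j).1 = v then 1 else 0) +
      ∑ j, ∑ l : Fin (k - 1), if (f j).2 l = v then 1 else 0 := by
    rw [mul_sum, ← sum_add_distrib, ← sum_add_distrib]
    refine sum_congr rfl fun j _ => ?_
    by_cases hj : (f j).support.card = k
    · have := MultiIndex.ite_mem_support hk hj v
      simp only [hj, true_and]
      rw [this]
      split_ifs <;> simp <;> omega
    · have h := (hdiag j).resolve_right hj
      simp only [hj, false_and, if_false, h _, mul_zero]
  rw [hdeg]
  refine ⟨∑ j, if (f j).support.card = k ∧ (f j).1 = v then 1 else 0, ?_⟩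
  have hbal' : (∑ j, ∑ _l : Fin (k - 1), if (f j).1 = v then 1 else 0) =
      ∑ j, ∑ l : Fin (k - 1), if (f j).2 l = v then 1 else 0 := by
    convert hbal
    all_goals rfl
  omega

theorem HasEulerTour.isVeblen (hf : f.HasEulerTour) (hk : 2 ≤ k)
    (hdiag : ∀ j, (f j).IsDiag ∨ (f j).support.card = k) : f.hypergraph.IsVeblen k := by
  refine ⟨fun e he => ?_, fun v _ => hf.dvd_degree hk hdiag v⟩
  obtain ⟨j, hj, rfl⟩ := mem_hypergraph_edges.1 he
  exact hj

theorem verts_nonempty (hd : 1 ≤ d) : f.verts.Nonempty :=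
  ⟨(f ⟨0, hd⟩).1, mem_biUnion.2 ⟨_, mem_univ _, mem_insert_self _ _⟩⟩

theorem HasEulerTour.isConnected (hf : f.HasEulerTour) (hk : 2 ≤ k) (hd : 1 ≤ d)
    (hdiag : ∀ j, (f j).IsDiag ∨ (f j).support.card = k) : f.hypergraph.IsConnected := by
  refine ⟨verts_nonempty hd, fun u hu v hv => ?_⟩
  obtain ⟨a, rfl⟩ := (hf.mem_verts hk).1 hu
  obtain ⟨b, rfl⟩ := (hf.mem_verts hk).1 hv
  obtain ⟨e, he⟩ := hasEulerTour_iff.1 hf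
  refine ArcTrail.rel_of_mem_tours he (fun _ => .refl) (fun _ _ _ => .trans) (fun c => ?_) a b
  rcases hdiag c.1 with h | h
  · rw [tgt, h c.2]
    exact .refl
  · refine .single ⟨(f c.1).support, mem_hypergraph_edges.2 ⟨c.1, h, rfl⟩,
      mem_insert_self _ _, mem_insert_of_mem (mem_image_of_mem _ (mem_univ _))⟩

/-- The number of terms of `f` that are sets of `k` distinct vertices. -/
theorem card_hypergraph_edges :
    f.hypergraph.edges.card = (univ.filter fun j => (f j).support.card = k).card := by
  rw [hypergraph, Multiset.card_map]
  rfl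

theorem card_hypergraph_edges_le : f.hypergraph.edges.card ≤ d := by
  rw [card_hypergraph_edges]
  exact (card_filter_le _ _).trans (by simp)

theorem card_hypergraph_edges_eq_iff :
    f.hypergraph.edges.card = d ↔ ∀ j, (f j).support.card = k := by
  rw [card_hypergraph_edges]
  have h := card_filter_eq_iff (s := (univ : Finset (Fin d)))
    (p := fun j => (f j).support.card = k)
  simpa using h

theorem card_hypergraph_edges_eq_zero_iff :
    f.hypergraph.edges.card = 0 ↔ ∀ j, (f j).support.card ≠ k := by
  rw [card_hypergraph_edges, card_eq_zero, filter_eq_empty_iff]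
  simp

/-- The sequence with all letters equal to `i`. -/
def loops (d k : ℕ) {n : ℕ} (i : Fin n) : IndexSeq d k n :=
  fun _ => (i, fun _ => i)

theorem isOrdered_loops (i : Fin n) : (loops d k i).IsOrdered :=
  fun _ _ _ => le_rfl

theorem hasEulerTour_loops (i : Fin n) : (loops d k i).HasEulerTour :=
  ⟨(Fintype.equivFinOfCardEq (by simp)).symm, fun _ => rfl⟩

theorem verts_loops (hd : 1 ≤ d) (i : Fin n) : (loops d k i).verts = {i} := by
  refine Subset.antisymm ?_ ?_
  · intro v
    simp only [verts, loops, MultiIndex.support, mem_biUnion, mem_univ, true_and, mem_insert,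
      mem_image, mem_singleton]
    rintro ⟨-, rfl | ⟨-, rfl⟩⟩ <;> rfl
  · rw [singleton_subset_iff]
    exact mem_biUnion.2 ⟨⟨0, hd⟩, mem_univ _, mem_insert_self _ _⟩

theorem outDegree_loops (i : Fin n) : (loops d k i).outDegree i = d * (k - 1) := by
  simp [outDegree_eq, loops]

theorem tau_loops (hd : 1 ≤ d) (i : Fin n) : (loops d k i).tau i = 1 := by
  rw [tau, card_eq_one]
  refine ⟨∅, ?_⟩
  ext T
  simp only [mem_filter, mem_univ, true_and, mem_singleton, IsRootedSpanningTree,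
    verts_loops hd]
  constructor
  · rintro ⟨h, -⟩
    exact eq_empty_of_forall_notMem fun a ha => h a ha rfl
  · rintro rfl
    simp [Relation.ReflTransGen.refl]

theorem HasEulerTour.eq_loops (hf : f.HasEulerTour) (hk : 2 ≤ k) (hd : 1 ≤ d)
    (h : ∀ j, (f j).IsDiag) : ∃ i, loops d k i = f := by
  obtain ⟨e, he⟩ := hasEulerTour_iff.1 hf
  have h0 : ∀ j, (f ⟨0, hd⟩).1 = (f j).1 := fun j =>
    ArcTrail.rel_of_mem_tours he (R := Eq) (fun _ => rfl) (fun _ _ _ => Eq.trans)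
      (fun a => (h a.1 a.2).symm) (⟨0, hd⟩, ⟨0, by omega⟩) (j, ⟨0, by omega⟩)
  refine ⟨(f ⟨0, hd⟩).1, funext fun j => Prod.ext (h0 j) (funext fun l => ?_)⟩
  rw [h j l, ← h0 j]
  rfl

end IndexSeq

/-! ### Entries of `A_α` along a sequence -/

namespace Hypergraph

variable {d k n : ℕ} {H : Hypergraph (Fin n)} {α : ℝ}

theorem alphaTensor_apply (i : Fin n) (β : Fin (k - 1) → Fin n) :
    H.alphaTensor k α i β =
      (α : ℂ) * H.degreeTensor k i β + (1 - (α : ℂ)) * H.adjTensor k i β :=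
  rfl

theorem adjTensor_eq_zero (hH : H.IsKUniform k) {x : MultiIndex k n} (hx : x.support.card ≠ k) :
    H.adjTensor k x.1 x.2 = 0 :=
  if_neg fun h => hx ((Set.ncard_coe_finset _).symm.trans (hH _ h))

theorem degreeTensor_eq_zero {x : MultiIndex k n} (hx : ¬ x.IsDiag) :
    H.degreeTensor k x.1 x.2 = 0 :=
  if_neg hx

theorem isDiag_or_mem_of_alphaTensor_ne_zero {x : MultiIndex k n}
    (hx : H.alphaTensor k α x.1 x.2 ≠ 0) :
    x.IsDiag ∨ (x.support : Set (Fin n)) ∈ H.edgeSet := by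
  by_contra! h
  refine hx ?_
  rw [alphaTensor_apply, degreeTensor_eq_zero h.1, adjTensor, if_neg h.2]
  simp

theorem tensorProd_alphaTensor_of_card_eq (hk : 2 ≤ k) {f : IndexSeq d k n}
    (hf : ∀ j, (f j).support.card = k) :
    f.tensorProd (H.alphaTensor k α) = (1 - (α : ℂ)) ^ d * f.tensorProd (H.adjTensor k) := by
  have : ∀ j, H.alphaTensor k α (f j).1 (f j).2 =
      (1 - (α : ℂ)) * H.adjTensor k (f j).1 (f j).2 := fun j => by
    rw [alphaTensor_apply, degreeTensor_eq_zero fun h => h.card_support_ne hk (hf j)]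
    simp
  simp [IndexSeq.tensorProd, this, prod_mul_distrib]

theorem tensorProd_adjTensor_eq_zero (hH : H.IsKUniform k) {f : IndexSeq d k n}
    (hf : ¬ ∀ j, (f j).support.card = k) : f.tensorProd (H.adjTensor k) = 0 := by
  obtain ⟨j, hj⟩ := not_forall.1 hf
  exact prod_eq_zero (mem_univ j) (adjTensor_eq_zero hH hj)

theorem tensorProd_alphaTensor_loops (hk : 2 ≤ k) (hH : H.IsKUniform k) (i : Fin n) :
    (IndexSeq.loops d k i).tensorProd (H.alphaTensor k α) =
      ((α : ℂ) * H.vertexDegree i) ^ d := by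
  have h1 : H.adjTensor k i (fun _ => i) = 0 :=
    adjTensor_eq_zero (x := (i, fun _ => i)) hH
      (MultiIndex.IsDiag.card_support_ne (fun _ => rfl) hk)
  have h2 : H.degreeTensor k i (fun _ => i) = H.vertexDegree i := if_pos fun _ => rfl
  simp [IndexSeq.tensorProd, IndexSeq.loops, alphaTensor_apply, h1, h2]

theorem isDiag_or_card_of_tensorProd_ne_zero (hH : H.IsKUniform k) {f : IndexSeq d k n}
    (hf : f.tensorProd (H.alphaTensor k α) ≠ 0) (j : Fin d) :
    (f j).IsDiag ∨ (f j).support.card = k :=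
  (isDiag_or_mem_of_alphaTensor_ne_zero (prod_ne_zero_iff.1 hf j (mem_univ j))).imp_right
    fun h => (Set.ncard_coe_finset _).symm.trans (hH _ h)

theorem hypergraph_mem_veblenInfragraphs (hk : 2 ≤ k) (hV : H.vertexSet = Set.univ)
    (hH : H.IsKUniform k) {f : IndexSeq d k n} (hf : f.HasEulerTour)
    (hprod : f.tensorProd (H.alphaTensor k α) ≠ 0) (h0 : f.hypergraph.edges.card ≠ 0)
    (h1 : f.hypergraph.edges.card ≠ d) :
    f.hypergraph ∈ H.veblenInfragraphs k (d - 1) := by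
  have hle := f.card_hypergraph_edges_le
  have hdiag := isDiag_or_card_of_tensorProd_ne_zero hH hprod
  simp only [veblenInfragraphs, mem_filter, Set.Finite.mem_toFinset, Set.mem_ofPred_eq]
  refine ⟨by omega, ⟨by simp [hV], fun e he => ?_⟩, hf.isVeblen hk hdiag,
    hf.isConnected hk (by omega) hdiag, fun h => h0 (by rw [h]; rfl)⟩
  obtain ⟨j, hj, rfl⟩ := IndexSeq.mem_hypergraph_edges.1 he
  refine (isDiag_or_mem_of_alphaTensor_ne_zero
    (prod_ne_zero_iff.1 hprod j (mem_univ j))).resolve_left fun h => ?_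
  exact h.card_support_ne hk hj

end Hypergraph

theorem mainTheorem1 (k n d : ℕ) (hk : 2 ≤ k) (hd : 1 ≤ d)
    (H : Hypergraph (Fin n)) (hV : H.vertexSet = Set.univ) (hH : H.IsKUniform k)
    (α : ℝ) (hα₀ : 0 ≤ α) (hα₁ : α ≤ 1)
    (root : IndexSeq d k n → Fin n) (hroot : ∀ f, root f ∈ f.verts) :
    (H.alphaTensor k α).trace d =
      H.phi k α d + (1 - (α : ℂ)) ^ d * (H.adjTensor k).trace d +
        (d : ℂ) * ((k - 1 : ℕ) : ℂ) ^ n *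
          ∑ G ∈ H.veblenInfragraphs k (d - 1), ∑ f ∈ G.indexSeqs d k,
            (f.tau (root f) : ℂ) * f.tensorProd (H.alphaTensor k α) /
              ∏ v ∈ f.verts, (f.outDegree v : ℂ) := by
  have htr := fun A => Tensor.trace_eq_sum_tau hk hd A root hroot
  rw [htr, htr]
  set F := univ.filter fun f : IndexSeq d k n => f.IsOrdered ∧ f.HasEulerTour with hF
  let c : IndexSeq d k n → ℕ := fun f => f.hypergraph.edges.card
  let w : IndexSeq d k n → ℂ := fun f =>
    (f.tau (root f) : ℂ) * f.tensorProd (H.alphaTensor k α) / ∏ v ∈ f.verts, (f.outDegree v : ℂ)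
  -- The cases `c f = 0` and `c f = d` exclude each other because `d ≥ 1`.
  have hsplit : ∑ f ∈ F, w f = ∑ f ∈ F.filter (fun f => c f = 0), w f +
      ∑ f ∈ F.filter (fun f => c f = d), w f +
      ∑ f ∈ F.filter (fun f => c f ≠ 0 ∧ c f ≠ d), w f := by
    rw [sum_filter (p := fun f => c f = 0), sum_filter (p := fun f => c f = d),
      sum_filter (p := fun f => c f ≠ 0 ∧ c f ≠ d), ← sum_add_distrib, ← sum_add_distrib]
    refine sum_congr rfl fun f _ => ?_
    by_cases h0 : c f = 0
    · simp [h0, show (0 : ℕ) ≠ d by omega]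
    · by_cases h1 : c f = d <;> simp [h0, h1]
      omega
  have hloops : (d : ℂ) * ((k - 1 : ℕ) : ℂ) ^ n * ∑ f ∈ F.filter (fun f => c f = 0), w f =
      H.phi k α d := by
    have himage : ∑ f ∈ F.filter (fun f => c f = 0), w f =
        ∑ i, w (IndexSeq.loops d k i) := by
      rw [← sum_image (g := IndexSeq.loops d k) (f := w) (s := univ)]
      · symm
        refine sum_subset ?_ ?_
        · intro f hf
          obtain ⟨i, -, rfl⟩ := mem_image.1 hf
          refine mem_filter.2 ⟨mem_filter.2 ⟨mem_univ _, IndexSeq.isOrdered_loops i,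
            IndexSeq.hasEulerTour_loops i⟩, IndexSeq.card_hypergraph_edges_eq_zero_iff.2 ?_⟩
          exact fun j => MultiIndex.IsDiag.card_support_ne (fun _ => rfl) hk
        · intro f hf hf'
          obtain ⟨hfF, hfc⟩ := mem_filter.1 hf
          have hfc := IndexSeq.card_hypergraph_edges_eq_zero_iff.1 hfc
          have : f.tensorProd (H.alphaTensor k α) = 0 := by
            by_contra h
            obtain ⟨i, hi⟩ := (mem_filter.1 hfF).2.2.eq_loops hk hd fun j =>
              (Hypergraph.isDiag_or_card_of_tensorProd_ne_zero hH h j).resolve_right (hfc j)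
            exact hf' (mem_image.2 ⟨i, mem_univ _, hi⟩)
          simp [w, this]
      · intro i _ i' _ h
        exact congrArg Prod.fst (congrFun h ⟨0, hd⟩)
    -- The only vertex has `d(k-1)` loops and `τ = 1`. The denominator cancels `d` and one power of
    -- `k - 1`, leaving the `(k-1)^(n-1)` of `φ`.
    have hw : ∀ i, w (IndexSeq.loops d k i) =
        ((α : ℂ) * H.vertexDegree i) ^ d / ((d : ℂ) * ((k - 1 : ℕ) : ℂ)) := by
      intro i
      have hr : root (IndexSeq.loops d k i) = i := by
        simpa [IndexSeq.verts_loops hd] using hroot (IndexSeq.loops d k i)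
      simp only [w]
      rw [hr, IndexSeq.tau_loops hd, IndexSeq.verts_loops hd, prod_singleton,
        IndexSeq.outDegree_loops, Hypergraph.tensorProd_alphaTensor_loops hk hH]
      push_cast
      ring
    rw [himage, Hypergraph.phi, mul_sum, mul_sum]
    refine sum_congr rfl fun i _ => ?_
    obtain ⟨n, rfl⟩ := Nat.exists_eq_succ_of_ne_zero (Fin.pos i).ne'
    have hd' : (d : ℂ) ≠ 0 := Nat.cast_ne_zero.2 (by omega)
    have hk' : ((k - 1 : ℕ) : ℂ) ≠ 0 := Nat.cast_ne_zero.2 (by omega)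
    rw [hw, mul_pow, pow_succ, show n.succ - 1 = n from rfl]
    field_simp
  have hedges : ∑ f ∈ F.filter (fun f => c f = d), w f = (1 - (α : ℂ)) ^ d *
      ∑ f ∈ F, (f.tau (root f) : ℂ) * f.tensorProd (H.adjTensor k) /
        ∏ v ∈ f.verts, (f.outDegree v : ℂ) := by
    rw [mul_sum, sum_filter]
    refine sum_congr rfl fun f _ => ?_
    split_ifs with h
    · simp only [w]
      rw [Hypergraph.tensorProd_alphaTensor_of_card_eq hk
        (IndexSeq.card_hypergraph_edges_eq_iff.1 h)]
      ring
    -- A sequence with a non-hyperedge term has weight zero in `Tr_d(A)`, so the restriction `c f =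
    -- d` costs nothing there.
    · rw [Hypergraph.tensorProd_adjTensor_eq_zero hH
        (mt IndexSeq.card_hypergraph_edges_eq_iff.2 h)]
      simp
  have hmixed : ∑ f ∈ F.filter (fun f => c f ≠ 0 ∧ c f ≠ d), w f =
      ∑ G ∈ H.veblenInfragraphs k (d - 1), ∑ f ∈ G.indexSeqs d k, w f := by
    have hfib : ∀ G ∈ H.veblenInfragraphs k (d - 1), ∑ f ∈ G.indexSeqs d k, w f =
        ∑ f ∈ (F.filter fun f => f.hypergraph ∈ H.veblenInfragraphs k (d - 1)).filter
          (fun f => f.hypergraph = G), w f := by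
      intro G hG
      refine sum_congr ?_ fun _ _ => rfl
      ext f
      simp only [MultiHypergraph.indexSeqs, hF, mem_filter, mem_univ, true_and]
      constructor
      · rintro ⟨h1, rfl, h2⟩
        exact ⟨⟨⟨h1, h2⟩, hG⟩, rfl⟩
      · rintro ⟨⟨⟨h1, h2⟩, -⟩, h3⟩
        exact ⟨h1, h3, h2⟩
    rw [(sum_congr rfl hfib).trans (sum_fiberwise_of_maps_to (fun f hf => (mem_filter.1 hf).2) w)]
    symm
    -- A Veblen infragraph in the index set has between `1` and `d - 1` hyperedges, so its sequences
    -- are mixed. Conversely, a mixed sequence whose `H_f` is not in the index set has `π_f = 0`.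
    refine sum_subset ?_ ?_
    · intro f hf
      obtain ⟨hfF, hf⟩ := mem_filter.1 hf
      simp only [Hypergraph.veblenInfragraphs, mem_filter, Set.Finite.mem_toFinset,
        Set.mem_ofPred_eq] at hf
      refine mem_filter.2 ⟨hfF, fun h => hf.2.2.2.2 (Multiset.card_eq_zero.1 h), fun h => ?_⟩
      have := hf.1
      simp only [c] at h
      omega
    · intro f hf hf'
      obtain ⟨hfF, h0, h1⟩ := mem_filter.1 hf
      have : f.tensorProd (H.alphaTensor k α) = 0 := by
        by_contra h
        exact hf' (mem_filter.2 ⟨hfF, Hypergraph.hypergraph_mem_veblenInfragraphs hk hV hH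
          (mem_filter.1 hfF).2.2 h h0 h1⟩)
      simp [w, this]
  rw [← hloops]
  change _ * ∑ f ∈ F, w f = _ + _ + _ * ∑ G ∈ _, ∑ f ∈ _, w f
  rw [← hmixed, hsplit, hedges]
  ring
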